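/- Let $n\ge 0$ and let $(\mathbb{R}^n,G)$ be a real Minkowski space. That is, $G:T\mathbb{R}^n=\mathbb{R}^n\times\mathbb{R}^n\to[0,\infty)$, $(x,u)\mapsto G(x;u)$, is a real Finsler metric: it is continuous, it is smooth where $u\neq 0$, $G(x;u)=0$ if and only if $u=0$, $G(x;\lambda u)=|\lambda|^2G(x;u)$ for all $\lambda\in\mathbb{R}$, and the matrix $\bigl(\tfrac12\,\partial^2G/\partial u^i\partial u^j\bigr)$ is positive definite where $u\ne0$. Moreover, $G(x;u)$ does not depend on $x$. A geodesic of $G$ is a curve $\gamma:[0,r]\to\mathbb{R}^n$ that is either constant, or of class $C^2$ with nowhere vanishing velocity $T=\dot\gamma$ and $\nabla_{T^H}T^H=0$. Here $\nabla$ is the covariant differentiation of the Cartan connection of $G$ and $T^H$ is the horizontal lift of $T$. In coordinates, the equation reads $\ddot\gamma^j+\Gamma^j_{i;k}(\gamma;\dot\gamma)\,\dot\gamma^i\dot\gamma^k=0$ with the horizontal coefficients $\Gamma^j_{i;k}$ of that connection. For $p\in\mathbb{R}^n$ and $u\in T_p\mathbb{R}^n=\mathbb{R}^n$ let $\exp_p(u)=\gamma(1)$,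 where $\gamma:[0,1]\to\mathbb{R}^n$ is the geodesic with $\gamma(0)=p$ and $\dot\gamma(0)=u$. Then for every $p\in\mathbb{R}^n$ the map $\exp_p$ is well defined on all of $T_p\mathbb{R}^n$, and it is an $E$-diffeomorphism at the origin: $\exp_p:T_p\mathbb{R}^n\to\mathbb{R}^n$ is a homeomorphism, $\exp_p$ and its inverse are of class $C^1$, and $\exp_p$ restricts to a $C^\infty$ diffeomorphism from $T_p\mathbb{R}^n\setminus\{0\}$ onto $\mathbb{R}^n\setminus\{\exp_p(0)\}$. In other words, $p$ is a pole of $(\mathbb{R}^n,G)$. -/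

import Mathlib

open scoped ContDiff

namespace RealFinsler

noncomputable section

/-- The space `ℝⁿ`; it is also the tangent space at each of its points. -/
abbrev RSpace (n : ℕ) : Type := EuclideanSpace ℝ (Fin n)

/-- The `i`-th standard basis vector of `ℝⁿ`. -/
def stdVec {n : ℕ} (i : Fin n) : RSpace n := EuclideanSpace.single i 1

/-- `∂ f / ∂ xⁱ` for a function `f (x; u)` on `Tℝⁿ = ℝⁿ × ℝⁿ`. -/
def dX {n : ℕ} (i : Fin n) (f : RSpace n → RSpace n → ℝ) (x u : RSpace n) : ℝ :=
  fderiv ℝ (fun y => f y u) x (stdVec i)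

/-- `∂ f / ∂ uⁱ` for a function `f (x; u)` on `Tℝⁿ = ℝⁿ × ℝⁿ`. -/
def dU {n : ℕ} (i : Fin n) (f : RSpace n → RSpace n → ℝ) (x u : RSpace n) : ℝ :=
  fderiv ℝ (fun w => f x w) u (stdVec i)

/-- The matrix `G_{ij} = ∂² G / ∂uⁱ ∂uʲ`. -/
def vertHess {n : ℕ} (G : RSpace n → RSpace n → ℝ) (x u : RSpace n) :
    Matrix (Fin n) (Fin n) ℝ :=
  Matrix.of fun i j => dU j (dU i G) x u

/-- The fundamental tensor `g_{ij} = ½ G_{ij}`. -/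
def fundTensor {n : ℕ} (G : RSpace n → RSpace n → ℝ) (x u : RSpace n) :
    Matrix (Fin n) (Fin n) ℝ :=
  (1 / 2 : ℝ) • vertHess G x u

/-- A real Finsler metric on `ℝⁿ`. The function `G` is the square of the Finsler norm. -/
structure IsFinslerMetric {n : ℕ} (G : RSpace n → RSpace n → ℝ) : Prop where
  continuous : Continuous fun z : RSpace n × RSpace n => G z.1 z.2
  smooth : ContDiffOn ℝ ∞ (fun z : RSpace n × RSpace n => G z.1 z.2) {z | z.2 ≠ 0}
  nonneg : ∀ x u, 0 ≤ G x u
  eq_zero_iff : ∀ x u, G x u = 0 ↔ u = 0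
  homogeneous : ∀ (x u : RSpace n) (c : ℝ), G x (c • u) = |c| ^ 2 * G x u
  posDef : ∀ x u, u ≠ 0 → (fundTensor G x u).PosDef

/-- `(ℝⁿ, G)` is a real Minkowski space: `G` is a real Finsler metric on `ℝⁿ` whose value on a
tangent vector does not depend on the base point. -/
structure IsMinkowski {n : ℕ} (G : RSpace n → RSpace n → ℝ) : Prop
    extends IsFinslerMetric G where
  translation_invariant : ∀ x y u, G x u = G y u

/-- The entries `G^{ij}` of the inverse matrix of `(G_{ij})`. -/
def invHess {n : ℕ} (G : RSpace n → RSpace n → ℝ) (i j : Fin n) (x u : RSpace n) : ℝ :=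
  (vertHess G x u)⁻¹ i j

/-- The vertical coefficients `Γ^j_{ik} = ½ G^{jl} G_{ikl}` of the Cartan connection. -/
def vertGamma {n : ℕ} (G : RSpace n → RSpace n → ℝ) (j i k : Fin n) (x u : RSpace n) : ℝ :=
  (1 / 2) * ∑ l, invHess G j l x u * dU l (dU k (dU i G)) x u

/-- The coefficients of the nonlinear connection,
`Γ^j_{;i} = ½ G^{jk} (G_{ki;b} u^b + G_{k;i} - G_{i;k}) - Γ^j_{ik} G^{kl} (G_{l;b} u^b - G_{;l})`,
where an index after the semicolon is a derivative with respect to `x`. -/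
def nonlinGamma {n : ℕ} (G : RSpace n → RSpace n → ℝ) (j i : Fin n) (x u : RSpace n) : ℝ :=
  (1 / 2) * ∑ k, invHess G j k x u *
      ((∑ b, dX b (dU i (dU k G)) x u * u b) + dX i (dU k G) x u - dX k (dU i G) x u)
    - ∑ k, ∑ l, vertGamma G j i k x u * invHess G k l x u *
      ((∑ b, dX b (dU l G) x u * u b) - dX l G x u)

/-- The horizontal derivation `δ_i = ∂/∂xⁱ - Γ^j_{;i} ∂/∂uʲ`, applied to a function `f (x; u)`. -/
def delta {n : ℕ} (G : RSpace n → RSpace n → ℝ) (i : Fin n) (f : RSpace n → RSpace n → ℝ)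
    (x u : RSpace n) : ℝ :=
  dX i f x u - ∑ j, nonlinGamma G j i x u * dU j f x u

/-- The horizontal coefficients of the Cartan connection,
`Γ^j_{i;k} = ½ G^{jl} (δ_k G_{il} + δ_i G_{lk} - δ_l G_{ik})`. -/
def horGamma {n : ℕ} (G : RSpace n → RSpace n → ℝ) (j i k : Fin n) (x u : RSpace n) : ℝ :=
  (1 / 2) * ∑ l, invHess G j l x u *
    (delta G k (dU l (dU i G)) x u + delta G i (dU k (dU l G)) x u - delta G l (dU k (dU i G)) x u)

/-- The velocity `γ̇` of a curve `γ : [0, r] → ℝⁿ`, with one-sided derivatives at the ends. -/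
def velocity {n : ℕ} (γ : ℝ → RSpace n) (r t : ℝ) : RSpace n :=
  derivWithin γ (Set.Icc 0 r) t

/-- The `j`-th component of `∇_{T^H} ξ^H`, the covariant derivative with respect to the Cartan
connection of a vector field `ξ` along `γ : [0, r] → ℝⁿ`, where `T = γ̇`. -/
def covDeriv {n : ℕ} (G : RSpace n → RSpace n → ℝ) (γ : ℝ → RSpace n) (r : ℝ)
    (ξ : ℝ → RSpace n) (j : Fin n) (t : ℝ) : ℝ :=
  derivWithin (fun s => ξ s j) (Set.Icc 0 r) t
    + ∑ i, ∑ k, horGamma G j i k (γ t) (velocity γ r t) * ξ t i * velocity γ r t k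

/-- The curve `γ : [0, r] → ℝⁿ` is a (constant speed) geodesic of `G`: it is either constant, or
regular with `∇_{T^H} T^H = 0` for `T = γ̇`. The values of `γ` outside `[0, r]` play no role. -/
def IsGeodesic {n : ℕ} (G : RSpace n → RSpace n → ℝ) (γ : ℝ → RSpace n) (r : ℝ) : Prop :=
  (∀ t ∈ Set.Icc 0 r, γ t = γ 0) ∨
  (ContDiffOn ℝ 2 γ (Set.Icc 0 r) ∧ (∀ t ∈ Set.Icc 0 r, velocity γ r t ≠ 0) ∧
    ∀ t ∈ Set.Icc 0 r, ∀ j, covDeriv G γ r (velocity γ r) j t = 0)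

/-- There is a geodesic `γ : [0, 1] → ℝⁿ` with `γ(0) = p`, `γ̇(0) = u` and `γ(1) = x`. -/
def GeodesicReaches {n : ℕ} (G : RSpace n → RSpace n → ℝ) (p u x : RSpace n) : Prop :=
  ∃ γ : ℝ → RSpace n, IsGeodesic G γ 1 ∧ γ 0 = p ∧ velocity γ 1 0 = u ∧ γ 1 = x

/-- The domain of `exp_p`: the vectors `u` for which the geodesic with initial point `p` and initial
velocity `u` is defined up to time `1` (and determines its end point). -/
def expDomain {n : ℕ} (G : RSpace n → RSpace n → ℝ) (p : RSpace n) : Set (RSpace n) :=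
  {u | ∃! x, GeodesicReaches G p u x}

open Classical in
/-- The exponential map: `exp_p(u) = γ(1)` for the geodesic `γ` with `γ(0) = p`, `γ̇(0) = u`.
Outside its domain it has the dummy value `p`. -/
def expMap {n : ℕ} (G : RSpace n → RSpace n → ℝ) (p u : RSpace n) : RSpace n :=
  if h : ∃! x, GeodesicReaches G p u x then h.choose else p

/-- `f` is an `E`-diffeomorphism at `a`: a homeomorphism that is of class `C¹` together with its
inverse, and a smooth diffeomorphism between the complements of `a` and `f a`. -/
def IsEDiffeomorphismAt {n : ℕ} (f : RSpace n → RSpace n) (a : RSpace n) : Prop :=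
  ∃ e : RSpace n ≃ₜ RSpace n, (∀ v, e v = f v) ∧
    ContDiff ℝ 1 e ∧ ContDiff ℝ 1 e.symm ∧
    ContDiffOn ℝ ∞ e {a}ᶜ ∧ ContDiffOn ℝ ∞ e.symm {f a}ᶜ

/-- `p` is a pole of `(ℝⁿ, G)`: the exponential map `exp_p` is defined on the whole tangent space
at `p`, and is an `E`-diffeomorphism at the origin onto `ℝⁿ`. -/
def IsPole {n : ℕ} (G : RSpace n → RSpace n → ℝ) (p : RSpace n) : Prop :=
  expDomain G p = Set.univ ∧ IsEDiffeomorphismAt (expMap G p) 0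

end

end RealFinsler

namespace RealFinsler

variable {n : ℕ}

/-! Since `G` is independent of `x`, so are all its vertical derivatives. Every term of the
nonlinear coefficients, and then of the horizontal coefficients, has a horizontal or `x`-derivative
of such a function as a factor, so all of them vanish (`horGamma_eq_zero`). The geodesic equation
becomes `γ'' = 0`, whose solutions are the affinely parametrized lines, the constant ones being
those with zero velocity (`isGeodesic_line`, `IsGeodesic.eq_line`). Hence `exp_p` is the translation
`u ↦ p + u` (`expMap_eq_add`), which is smooth with smooth inverse, even at the origin. -/

/-- A function that does not depend on the base point has no derivative in its direction. -/
lemma dX_eq_zero {f : RSpace n → RSpace n → ℝ} (hf : ∀ x y u, f x u = f y u)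
    (i : Fin n) (x u : RSpace n) : dX i f x u = 0 := by
  have h : (fun y => f y u) = fun _ => f 0 u := funext fun y => hf y 0 u
  simp [dX, h]

/-- Vertical derivatives preserve independence of the base point. -/
lemma dU_translation_invariant {f : RSpace n → RSpace n → ℝ} (hf : ∀ x y u, f x u = f y u)
    (i : Fin n) (x y u : RSpace n) : dU i f x u = dU i f y u := by
  simp only [dU]
  rw [show (fun w => f x w) = fun w => f y w from funext fun w => hf x y w]

/-- The nonlinear connection of a translation invariant metric vanishes. -/
lemma nonlinGamma_eq_zero {G : RSpace n → RSpace n → ℝ} (hG : ∀ x y u, G x u = G y u)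
    (j i : Fin n) (x u : RSpace n) : nonlinGamma G j i x u = 0 := by
  have h1 : ∀ i, ∀ x y u, dU i G x u = dU i G y u := dU_translation_invariant hG
  have h2 : ∀ i k, ∀ x y u, dU i (dU k G) x u = dU i (dU k G) y u :=
    fun i k => dU_translation_invariant (h1 k) i
  simp [nonlinGamma, dX_eq_zero hG, dX_eq_zero (h1 _), dX_eq_zero (h2 _ _)]

/-- The horizontal derivation of a translation invariant metric is `∂/∂x`, so that it annihilates
the functions that do not depend on the base point. -/
lemma delta_eq_zero {G f : RSpace n → RSpace n → ℝ} (hG : ∀ x y u, G x u = G y u)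
    (hf : ∀ x y u, f x u = f y u) (i : Fin n) (x u : RSpace n) : delta G i f x u = 0 := by
  simp [delta, dX_eq_zero hf, nonlinGamma_eq_zero hG]

/-- The horizontal coefficients of the Cartan connection of a translation invariant metric
vanish. -/
lemma horGamma_eq_zero {G : RSpace n → RSpace n → ℝ} (hG : ∀ x y u, G x u = G y u)
    (j i k : Fin n) (x u : RSpace n) : horGamma G j i k x u = 0 := by
  have h2 : ∀ i k, ∀ x y u, dU i (dU k G) x u = dU i (dU k G) y u :=
    fun i k => dU_translation_invariant (dU_translation_invariant hG k) i
  simp [horGamma, delta_eq_zero hG (h2 _ _)]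

/-- Covariant differentiation along curves is componentwise differentiation for a translation
invariant metric. -/
lemma covDeriv_eq_derivWithin {G : RSpace n → RSpace n → ℝ} (hG : ∀ x y u, G x u = G y u)
    (γ : ℝ → RSpace n) (r : ℝ) (ξ : ℝ → RSpace n) (j : Fin n) (t : ℝ) :
    covDeriv G γ r ξ j t = derivWithin (fun s => ξ s j) (Set.Icc 0 r) t := by
  simp [covDeriv, horGamma_eq_zero hG]

lemma velocity_of_eqOn_const {γ : ℝ → RSpace n} {r : ℝ} (h : ∀ t ∈ Set.Icc 0 r, γ t = γ 0)
    {t : ℝ} (ht : t ∈ Set.Icc 0 r) : velocity γ r t = 0 := by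
  rw [velocity, derivWithin_congr (f := fun _ => γ 0) h (h t ht)]
  simp

lemma velocity_line (p u : RSpace n) {r : ℝ} (hr : 0 < r) {t : ℝ} (ht : t ∈ Set.Icc 0 r) :
    velocity (fun s => p + s • u) r t = u := by
  have h : HasDerivAt (fun s : ℝ => p + s • u) u t := by
    simpa using ((hasDerivAt_id t).smul_const u).const_add p
  -- At the endpoints the velocity is one-sided; `0 < r` makes derivatives within the interval
  -- unique.
  exact h.hasDerivWithinAt.derivWithin (uniqueDiffOn_Icc hr t ht)

/-- The straight lines are geodesics of a translation invariant metric. -/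
lemma isGeodesic_line {G : RSpace n → RSpace n → ℝ} (hG : ∀ x y u, G x u = G y u)
    (p u : RSpace n) {r : ℝ} (hr : 0 < r) : IsGeodesic G (fun s => p + s • u) r := by
  by_cases hu : u = 0
  -- A regular geodesic has nonzero velocity, so `u = 0` must use the constant alternative.
  · left
    simp [hu]
  · refine Or.inr ⟨by fun_prop, fun t ht => by rwa [velocity_line p u hr ht], fun t ht j => ?_⟩
    -- The velocity is known to equal `u` only on `[0, r]`, hence the congruence within the
    -- interval.
    rw [covDeriv_eq_derivWithin hG, derivWithin_congr (f := fun _ => u j)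
      (fun s hs => by rw [velocity_line p u hr hs]) (by rw [velocity_line p u hr ht])]
    simp

/-- Every geodesic of a translation invariant metric is a straight line. -/
lemma IsGeodesic.eq_line {G : RSpace n → RSpace n → ℝ} (hG : ∀ x y u, G x u = G y u)
    {γ : ℝ → RSpace n} {r : ℝ} (hr : 0 < r) (h : IsGeodesic G γ r) {t : ℝ}
    (ht : t ∈ Set.Icc 0 r) : γ t = γ 0 + t • velocity γ r 0 := by
  have h0 : (0 : ℝ) ∈ Set.Icc 0 r := ⟨le_rfl, hr.le⟩
  rcases h with h | ⟨hC, -, hcov⟩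
  · rw [velocity_of_eqOn_const h h0, h t ht]
    simp
  have hU := uniqueDiffOn_Icc hr
  -- Class `C²` of `γ` is what allows the velocity to be differentiated once more.
  have hV : DifferentiableOn ℝ (velocity γ r) (Set.Icc 0 r) :=
    (hC.derivWithin hU (m := 1) (by norm_num)).differentiableOn (by norm_num)
  have hconst : ∀ s ∈ Set.Icc 0 r, velocity γ r s = velocity γ r 0 := by
    intro s hs
    ext j
    have hj : DifferentiableOn ℝ (fun s => velocity γ r s j) (Set.Icc 0 r) :=
      fun a ha => differentiableWithinAt_euclidean.1 (hV a ha) j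
    exact constant_of_derivWithin_zero hj (fun a ha => by
      rw [← covDeriv_eq_derivWithin hG γ r]
      exact hcov a ⟨ha.1, ha.2.le⟩ j) s hs
  have hγ : DifferentiableOn ℝ γ (Set.Icc 0 r) := hC.differentiableOn (by norm_num)
  have hline : DifferentiableOn ℝ (fun s : ℝ => γ 0 + s • velocity γ r 0) (Set.Icc 0 r) := by
    fun_prop
  -- The curve and the line start at `γ 0` and have the same velocity, so they agree.
  refine eq_of_derivWithin_eq hγ hline (fun s hs => ?_) (by simp) t ht
  have hs' : s ∈ Set.Icc 0 r := ⟨hs.1, hs.2.le⟩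
  exact (hconst s hs').trans (velocity_line (γ 0) (velocity γ r 0) hr hs').symm

/-- In a Minkowski space the geodesic with initial point `p` and initial velocity `u` ends
at `p + u`. -/
lemma geodesicReaches_iff {G : RSpace n → RSpace n → ℝ} (hG : ∀ x y u, G x u = G y u)
    (p u x : RSpace n) : GeodesicReaches G p u x ↔ x = p + u := by
  constructor
  · rintro ⟨γ, hγ, rfl, rfl, rfl⟩
    simpa using hγ.eq_line hG one_pos (t := 1) (by simp)
  · rintro rfl
    exact ⟨fun s => p + s • u, isGeodesic_line hG p u one_pos, by simp,
      velocity_line p u one_pos (by simp), by simp⟩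

/-- Membership of `u` in `expDomain G p` is exactly this statement. -/
lemma existsUnique_geodesicReaches {G : RSpace n → RSpace n → ℝ}
    (hG : ∀ x y u, G x u = G y u) (p u : RSpace n) : ∃! x, GeodesicReaches G p u x :=
  ⟨p + u, (geodesicReaches_iff hG p u _).2 rfl, fun _ => (geodesicReaches_iff hG p u _).1⟩

lemma expMap_eq_add {G : RSpace n → RSpace n → ℝ} (hG : ∀ x y u, G x u = G y u)
    (p u : RSpace n) : expMap G p u = p + u := by
  have h := existsUnique_geodesicReaches hG p u
  rw [expMap, dif_pos h]
  exact (geodesicReaches_iff hG p u _).1 h.choose_spec.1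

/-- Translations are `E`-diffeomorphisms at every point. -/
lemma isEDiffeomorphismAt_of_eq_add {f : RSpace n → RSpace n} {p : RSpace n}
    (hf : ∀ v, f v = p + v) (a : RSpace n) : IsEDiffeomorphismAt f a := by
  have h : ∀ m : WithTop ℕ∞, ContDiff ℝ m (Homeomorph.addLeft p) := fun m =>
    contDiff_const.add contDiff_id
  have h' : ∀ m : WithTop ℕ∞, ContDiff ℝ m (Homeomorph.addLeft p).symm := fun m =>
    -- The inverse is again a translation, by `-p`.
    contDiff_const.add contDiff_id
  exact ⟨Homeomorph.addLeft p, fun v => (hf v).symm, h 1, h' 1, (h _).contDiffOn,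
    (h' _).contDiffOn⟩

end RealFinsler

theorem mainTheorem11 (n : ℕ) (G : RealFinsler.RSpace n → RealFinsler.RSpace n → ℝ)
    (hG : RealFinsler.IsMinkowski G) (p : RealFinsler.RSpace n) :
    RealFinsler.IsPole G p :=
  ⟨Set.eq_univ_of_forall fun u =>
      RealFinsler.existsUnique_geodesicReaches hG.translation_invariant p u,
    RealFinsler.isEDiffeomorphismAt_of_eq_add
      (RealFinsler.expMap_eq_add hG.translation_invariant p) 0⟩
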